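/- Let $m>1$ be an integer, let $\mathbb Z_m=\varprojlim_n \mathbb Z/m^n\mathbb Z$ be the ring of $m$-adic integers ($m$ not necessarily prime), and let $\mathbb P$ be its Haar measure, normalized by $\mathbb P(\mathbb Z_m)=1$. For $\omega\in\mathbb Z_m$ let $\omega \bmod m^n$ be the representative in $[m^n]=\{0,\dots,m^n-1\}$ of the image of $\omega$ in $\mathbb Z/m^n\mathbb Z$, and put $\xi_n(\omega)=\omega\bmod m^n$. Let $\rho(x,y)=m^{-n}$, where $n$ is the first position at which the $m$-ary digits of $x$ and $y$ differ ($\rho(x,x)=0$). A map $g:\mathbb Z_m\to\mathbb Z_m$ is $1$-Lipschitz if for all $\varepsilon>0$, $\rho(x,y)<\varepsilon$ implies $\rho(g(x),g(y))<\varepsilon$. A collection $f_1,\dots,f_s$ of $1$-Lipschitz maps $\mathbb Z_m\to\mathbb Z_m$ is called *uniform with each suffix* if $$\lim_{n\to\infty}\mathbb P\left(\left(\frac{f_1(\omega)\bmod m^n}{m^n},\dots,\frac{f_s(\omega)\bmod m^n}{m^n}\right)\in J_k(\mathbf a)\ \middle|\ \xi_d=\beta\right)=V(J_k(\mathbf a))$$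 for all $k,d\in\mathbb N$, all $\mathbf a=(a_1,\dots,a_s)\in[m^k]^s$ and all $\beta\in[m^d]$, where $J_k(\mathbf a)=\prod_{i=1}^s\left[\frac{a_i}{m^k},\frac{a_i+1}{m^k}\right)$ and $V$ denotes the $s$-dimensional volume. **Theorem.** For any polynomial $f$ with integer coefficients and $\deg f>1$, and any $s\in\mathbb N$, the collection of maps $x, f, f^{(2)},\dots,f^{(s-1)}$ of $\mathbb Z_m$, where $x$ is the identity map and $f^{(i)}$ is the $i$-th iterate of $f$, is uniform with each suffix. -/

import Mathlib

open Filter Topology MeasureTheory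

/-- The ring of sequences `(x_n)` with `x_n ∈ ℤ/m^n` and `x_{n+1} ≡ x_n (mod m^n)`. -/
def madicSubring (m : ℕ) : Subring (∀ n : ℕ, ZMod (m ^ n)) where
  carrier := {x | ∀ n, ZMod.castHom (pow_dvd_pow m n.le_succ) (ZMod (m ^ n)) (x (n + 1)) = x n}
  mul_mem' := fun {a b} ha hb n => by
    rw [Pi.mul_apply, map_mul, ha n, hb n, Pi.mul_apply]
  one_mem' := fun n => map_one _
  add_mem' := fun {a b} ha hb n => by
    rw [Pi.add_apply, map_add, ha n, hb n, Pi.add_apply]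
  zero_mem' := fun n => map_zero _
  neg_mem' := fun {a} ha n => by
    rw [Pi.neg_apply, map_neg, ha n, Pi.neg_apply]

/-- The ring `ℤ_m` of `m`-adic integers (`m` need not be prime), as the inverse limit of the
rings `ℤ/m^n`. -/
def MAdicInt (m : ℕ) : Type := madicSubring m

namespace MAdicInt

noncomputable instance (m : ℕ) : CommRing (MAdicInt m) :=
  inferInstanceAs (CommRing (madicSubring m))

/-- The topology induced by the product of the discrete topologies on the `ℤ/m^n`. -/
instance (m : ℕ) : TopologicalSpace (MAdicInt m) :=
  TopologicalSpace.induced (fun (x : madicSubring m) => (x : ∀ n : ℕ, ZMod (m ^ n)))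
    (@Pi.topologicalSpace ℕ (fun n => ZMod (m ^ n)) fun _ => ⊥)

instance (m : ℕ) : IsTopologicalRing (MAdicInt m) := by
  let _ : ∀ n : ℕ, TopologicalSpace (ZMod (m ^ n)) := fun _ => ⊥
  have _ : ∀ n : ℕ, DiscreteTopology (ZMod (m ^ n)) := fun _ => ⟨rfl⟩
  exact inferInstanceAs (IsTopologicalRing (madicSubring m))

instance (m : ℕ) [NeZero m] : CompactSpace (MAdicInt m) := by
  let _ : ∀ n : ℕ, TopologicalSpace (ZMod (m ^ n)) := fun _ => ⊥
  have _ : ∀ n : ℕ, DiscreteTopology (ZMod (m ^ n)) := fun _ => ⟨rfl⟩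
  have hc : IsClosed (madicSubring m : Set (∀ n : ℕ, ZMod (m ^ n))) := by
    have h : (madicSubring m : Set (∀ n : ℕ, ZMod (m ^ n))) = ⋂ n : ℕ,
        {x | ZMod.castHom (pow_dvd_pow m n.le_succ) (ZMod (m ^ n)) (x (n + 1)) = x n} := by
      ext x
      simp only [Set.mem_iInter]
      exact Iff.rfl
    rw [h]
    exact isClosed_iInter fun n => isClosed_eq
      (continuous_of_discreteTopology.comp (continuous_apply (n + 1))) (continuous_apply n)
  exact isCompact_iff_compactSpace.mp hc.isCompact

instance (m : ℕ) : MeasurableSpace (MAdicInt m) := borel _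

instance (m : ℕ) : BorelSpace (MAdicInt m) := ⟨rfl⟩

/-- The Haar measure on `ℤ_m`, normalized so that `ℤ_m` has measure `1`. -/
noncomputable def haar (m : ℕ) [NeZero m] : Measure (MAdicInt m) :=
  Measure.addHaarMeasure ⊤

variable {m : ℕ}

/-- `x mod m^n`, an element of `{0, …, m^n - 1}`. As a function of the random point `x` of `ℤ_m`
this is the random variable `ξ_n`. -/
def residue (n : ℕ) (x : MAdicInt m) : ℕ :=
  ZMod.val ((show madicSubring m from x).1 n)

/-- The digit of `x` at position `i`, where `x = ∑ i, digit i x * m ^ i`. -/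
def digit (i : ℕ) (x : MAdicInt m) : ℕ :=
  residue (i + 1) x / m ^ i

open Classical in
/-- The distance `m ^ (-n)`, where `n` is the first position at which the digits of `x` and `y`
differ. -/
noncomputable def rho (x y : MAdicInt m) : ℝ :=
  if x = y then 0 else ((m : ℝ) ^ sInf {i : ℕ | digit i x ≠ digit i y})⁻¹

/-- The `1`-Lipschitz maps of `ℤ_m`. -/
def OneLipschitz (f : MAdicInt m → MAdicInt m) : Prop :=
  ∀ ε : ℝ, 0 < ε → ∀ x y : MAdicInt m, rho x y < ε → rho (f x) (f y) < ε

/-- The random vector `((f_1(ω) mod m^n) / m^n, …, (f_s(ω) mod m^n) / m^n)`. -/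
noncomputable def phi {s : ℕ} (f : Fin s → MAdicInt m → MAdicInt m) (n : ℕ) (ω : MAdicInt m) :
    Fin s → ℝ :=
  fun i => (residue n (f i ω) : ℝ) / (m : ℝ) ^ n

/-- The cube `∏ i, [a_i / m^k, (a_i + 1) / m^k)`. -/
def cube {s : ℕ} (k : ℕ) (a : Fin s → Fin (m ^ k)) : Set (Fin s → ℝ) :=
  {z | ∀ i, ((a i : ℕ) : ℝ) / (m : ℝ) ^ k ≤ z i ∧ z i < (((a i : ℕ) : ℝ) + 1) / (m : ℝ) ^ k}

/-- The collection `f_1, …, f_s` of `1`-Lipschitz maps of `ℤ_m` is uniform with each suffix: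
`ℙ(φ_n(f_1, …, f_s) ∈ J_k(a) | ξ_d = β) → V(J_k(a))` as `n → ∞`, for all `k`, `a`, `d`, `β`. -/
structure UniformWithEachSuffix [NeZero m] {s : ℕ} (f : Fin s → MAdicInt m → MAdicInt m) :
    Prop where
  oneLipschitz : ∀ i, OneLipschitz (f i)
  tendsto_cond : ∀ (k : ℕ) (a : Fin s → Fin (m ^ k)) (d : ℕ) (β : Fin (m ^ d)),
    Tendsto
      (fun n : ℕ => ProbabilityTheory.cond (haar m) {ω | residue d ω = (β : ℕ)}
        {ω | phi f n ω ∈ cube k a})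
      atTop (𝓝 (volume (cube k a)))

end MAdicInt

/-!
Equidistribution of the orbit `(ω, f(ω), …, f^(s-1)(ω))` is proved with Weyl's criterion. Reduction
mod `m ^ n` followed by division by `m ^ n` is the homomorphism
`ℤ_m → ℤ/m^n → ℝ/ℤ`, so the random vector of the theorem is a random point of the torus `(ℝ/ℤ)^s`,
and a cube with `m`-adic vertices becomes a product of half-open arcs, whose frontier is null. By
Stone–Weierstrass and the portmanteau theorem (`tendsto_measure_of_tendsto_mFourier`) it suffices
that for every `h ≠ 0` the integral of `ψ_n (P ω)` over `{ξ_d = β}` tends to `0`, where `ψ_n` is the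
standard character of `ℤ/m^n` and `P = ∑ i, h_i f^(i)`. Since `deg f > 1`, the iterates have
pairwise distinct positive degrees, so that `P` is not constant and `P' ≠ 0`
(`derivative_sum_smul_iterate_comp_ne_zero`).

The exponential integral is estimated by a shift. If `n ≤ 2 t` then
`P(ω + m^t z) ≡ P(ω) + m^t P'(ω) z` mod `m ^ n`, and for `d ≤ t` the shift by `m^t z` preserves both
Haar measure and `{ξ_d = β}`. Averaging over `z` mod `m ^ n` kills every `ω` with
`m^t P'(ω) ≢ 0` mod `m ^ n`, so the integral is at most the measure of
`{P'(ω) ≡ 0 mod m^(n-t)}` (`MAdicInt.norm_setIntegral_stdAddChar_le`). With `n - t = n / 2 → ∞`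
these sets decrease to the zero set of `P'` in `ℤ_m`. That set is null
(`MAdicInt.haar_zeros_eq_zero`): for a prime `p ∣ m`, the canonical map `ℤ_m → ℤ_p` sends it into
the finite set of roots of `P'` in the domain `ℤ_p`, and each fibre of this map has infinitely many
disjoint translates.
-/

/-! ### Weyl's criterion on the torus -/

instance : IsProbabilityMeasure (volume : Measure UnitAddCircle) :=
  ⟨by simp [AddCircle.measure_univ]⟩

instance : NullSingletonClass (volume : Measure UnitAddCircle) where
  measure_singleton x := by
    have hpre : ((fun y : ℝ => (y : UnitAddCircle)) ⁻¹' {x} ∩ Set.Ioc 0 (0 + 1)).Subsingleton :=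
      fun y hy z hz => (AddCircle.coe_eq_coe_iff_of_mem_Ioc hy.2 hz.2).mp (hy.1.trans hz.1.symm)
    rw [← (UnitAddCircle.measurePreserving_mk 0).measure_preimage
      (measurableSet_singleton x).nullMeasurableSet,
      Measure.restrict_apply' measurableSet_Ioc]
    exact hpre.measure_zero _

theorem integral_mFourier_of_ne_zero {s : ℕ} {h : Fin s → ℤ} (hh : h ≠ 0) :
    ∫ x, UnitAddTorus.mFourier h x = 0 := by
  obtain ⟨i, hi⟩ := Function.ne_iff.mp hh
  -- Translation by half a period of the `i`-th factor changes its sign.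
  have hfac : ∫ x : UnitAddCircle, fourier (h i) x = 0 :=
    integral_eq_zero_of_add_right_eq_neg (fourier_add_half_inv_index hi one_pos)
  simp only [UnitAddTorus.mFourier, ContinuousMap.coe_mk]
  rw [volume_pi, integral_fintype_prod_eq_prod (fun i x => fourier (h i) x)]
  exact Finset.prod_eq_zero (Finset.mem_univ i) hfac

/-- The trigonometric polynomials, for which convergence holds by assumption, are uniformly dense in
the continuous functions. -/
theorem tendsto_integral_of_tendsto_mFourier {s : ℕ} {μs : ℕ → Measure (UnitAddTorus (Fin s))}
    [∀ n, IsProbabilityMeasure (μs n)]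
    (hμ : ∀ h : Fin s → ℤ, h ≠ 0 →
      Tendsto (fun n => ∫ x, UnitAddTorus.mFourier h x ∂μs n) atTop (𝓝 0))
    (f : C(UnitAddTorus (Fin s), ℂ)) :
    Tendsto (fun n => ∫ x, f x ∂μs n) atTop (𝓝 (∫ x, f x)) := by
  have hint : ∀ (μ : Measure (UnitAddTorus (Fin s))) [IsProbabilityMeasure μ]
      (g : C(UnitAddTorus (Fin s), ℂ)), Integrable (fun x => g x) μ := fun μ _ g =>
    BoundedContinuousFunction.integrable μ (BoundedContinuousFunction.mkOfCompact g)
  have hspan : ∀ g ∈ Submodule.span ℂ (Set.range (UnitAddTorus.mFourier (d := Fin s))),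
      Tendsto (fun n => ∫ x, g x ∂μs n) atTop (𝓝 (∫ x, g x)) := by
    intro g hg
    induction hg using Submodule.span_induction with
    | mem g hg =>
      obtain ⟨h, rfl⟩ := hg
      by_cases hh : h = 0
      · simp [hh, UnitAddTorus.mFourier_zero]
      · simpa only [integral_mFourier_of_ne_zero hh] using hμ h hh
    | zero => simp
    | add g₁ g₂ _ _ h₁ h₂ =>
      simp only [ContinuousMap.add_apply]
      rw [integral_add (hint _ g₁) (hint _ g₂)]
      refine (h₁.add h₂).congr fun n => ?_
      rw [integral_add (hint _ g₁) (hint _ g₂)]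
    | smul c g _ h =>
      simp only [ContinuousMap.smul_apply, integral_smul]
      exact h.const_smul c
  have hf : f ∈ closure (Submodule.span ℂ
      (Set.range (UnitAddTorus.mFourier (d := Fin s))) : Set C(UnitAddTorus (Fin s), ℂ)) := by
    rw [← Submodule.topologicalClosure_coe, UnitAddTorus.span_mFourier_closure_eq_top]
    trivial
  have hdist : ∀ (μ : Measure (UnitAddTorus (Fin s))) [IsProbabilityMeasure μ]
      (g : C(UnitAddTorus (Fin s), ℂ)), dist (∫ x, f x ∂μ) (∫ x, g x ∂μ) ≤ dist f g := by
    intro μ _ g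
    rw [dist_eq_norm, ← integral_sub (hint μ f) (hint μ g)]
    simpa using norm_integral_le_of_norm_le_const (μ := μ) (C := dist f g)
      (ae_of_all _ fun x => by
        rw [← dist_eq_norm]
        exact ContinuousMap.dist_apply_le_dist x)
  rw [Metric.tendsto_atTop]
  intro ε hε
  obtain ⟨g, hg, hfg⟩ := Metric.mem_closure_iff.mp hf (ε / 3) (by positivity)
  obtain ⟨N, hN⟩ := Metric.tendsto_atTop.mp (hspan g hg) (ε / 3) (by positivity)
  refine ⟨N, fun n hn => ?_⟩
  have h₁ := hdist (μs n) g
  have h₂ := hdist volume g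
  rw [dist_comm] at h₂
  have h₃ := dist_triangle4 (∫ x, f x ∂μs n) (∫ x, g x ∂μs n) (∫ x, g x) (∫ x, f x)
  linarith [hN n hn]

/-- Weyl's criterion: if all nontrivial Fourier coefficients of a sequence of probability measures
on the torus tend to `0`, then the measures of each set with null frontier converge to its volume. -/
theorem tendsto_measure_of_tendsto_mFourier {s : ℕ} {μs : ℕ → Measure (UnitAddTorus (Fin s))}
    [∀ n, IsProbabilityMeasure (μs n)]
    (hμ : ∀ h : Fin s → ℤ, h ≠ 0 →
      Tendsto (fun n => ∫ x, UnitAddTorus.mFourier h x ∂μs n) atTop (𝓝 0))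
    {E : Set (UnitAddTorus (Fin s))} (hE : volume (frontier E) = 0) :
    Tendsto (fun n => μs n E) atTop (𝓝 (volume E)) := by
  let P : ℕ → ProbabilityMeasure (UnitAddTorus (Fin s)) := fun n => ⟨μs n, inferInstance⟩
  let P' : ProbabilityMeasure (UnitAddTorus (Fin s)) :=
    ⟨volume, by rw [volume_pi]; infer_instance⟩
  have hlim : Tendsto P atTop (𝓝 P') := by
    rw [ProbabilityMeasure.tendsto_iff_forall_integral_tendsto]
    intro g
    have key := tendsto_integral_of_tendsto_mFourier hμ
      ⟨fun x => (g x : ℂ), Complex.continuous_ofReal.comp g.continuous⟩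
    simp only [ContinuousMap.coe_mk, integral_complex_ofReal] at key
    exact (Complex.continuous_re.tendsto _).comp key
  exact ProbabilityMeasure.tendsto_measure_of_null_frontier_of_tendsto' hlim hE

/-! ### Half-open arcs and their products -/

/-- The image in the circle `ℝ/ℤ` of the interval `[a, b)`. -/
def circleArc (a b : ℝ) : Set UnitAddCircle := (fun x : ℝ => (x : UnitAddCircle)) '' Set.Ico a b

theorem isOpen_image_Ioo (a b : ℝ) :
    IsOpen ((fun x : ℝ => (x : UnitAddCircle)) '' Set.Ioo a b) :=
  QuotientAddGroup.isOpenMap_coe _ isOpen_Ioo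

theorem circleArc_eq_union {a b : ℝ} (hab : a < b) :
    circleArc a b = (fun x : ℝ => (x : UnitAddCircle)) '' Set.Ioo a b ∪ {(a : UnitAddCircle)} := by
  rw [circleArc, ← Set.Ioo_union_left hab, Set.image_union, Set.image_singleton]

theorem volume_circleArc {a b : ℝ} (hab : a < b) (hb : b ≤ a + 1) :
    volume (circleArc a b) = ENNReal.ofReal (b - a) := by
  have hpre : (fun x : ℝ => (x : UnitAddCircle)) ⁻¹'
      ((fun x : ℝ => (x : UnitAddCircle)) '' Set.Ioo a b) ∩ Set.Ioc a (a + 1) = Set.Ioo a b := by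
    ext x
    constructor
    · rintro ⟨⟨y, hy, hyx⟩, hx⟩
      have : y = x := (AddCircle.coe_eq_coe_iff_of_mem_Ioc
        ⟨hy.1, (hy.2.trans_le hb).le⟩ hx).mp hyx
      exact this ▸ hy
    · exact fun hx => ⟨⟨x, hx, rfl⟩, hx.1, (hx.2.trans_le hb).le⟩
  rw [circleArc_eq_union hab,
    measure_congr (union_ae_eq_left_of_ae_eq_empty (ae_eq_empty.mpr (measure_singleton _))),
    ← (UnitAddCircle.measurePreserving_mk a).measure_preimage
      (isOpen_image_Ioo a b).measurableSet.nullMeasurableSet,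
    Measure.restrict_apply' measurableSet_Ioc, hpre, Real.volume_Ioo]

theorem measurableSet_circleArc {a b : ℝ} (hab : a < b) : MeasurableSet (circleArc a b) := by
  rw [circleArc_eq_union hab]
  exact (isOpen_image_Ioo a b).measurableSet.union (measurableSet_singleton _)

theorem volume_frontier_circleArc (a b : ℝ) : volume (frontier (circleArc a b)) = 0 := by
  have hsub : frontier (circleArc a b) ⊆ {(a : UnitAddCircle), (b : UnitAddCircle)} := by
    rintro x ⟨hc, hi⟩
    have hclosed : IsClosed ((fun x : ℝ => (x : UnitAddCircle)) '' Set.Icc a b) :=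
      (isCompact_Icc.image (AddCircle.continuous_mk' 1)).isClosed
    obtain ⟨y, hy, rfl⟩ :=
      closure_minimal (Set.image_mono Set.Ico_subset_Icc_self) hclosed hc
    rcases eq_or_lt_of_le hy.1 with rfl | hay
    · exact Or.inl rfl
    rcases eq_or_lt_of_le hy.2 with rfl | hyb
    · exact Or.inr rfl
    exact absurd (interior_maximal (Set.image_mono Set.Ioo_subset_Ico_self)
      (isOpen_image_Ioo a b) ⟨y, ⟨hay, hyb⟩, rfl⟩) hi
  exact measure_mono_null hsub ((Set.toFinite _).measure_zero _)

/-- Since `[0, 1)` is a fundamental domain, an arc that does not wrap around pulls back to the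
interval it comes from. -/
theorem coe_mem_circleArc_iff {a b x : ℝ} (ha : 0 ≤ a) (hb : b ≤ 1) (hx : x ∈ Set.Ico (0 : ℝ) 1) :
    (x : UnitAddCircle) ∈ circleArc a b ↔ x ∈ Set.Ico a b := by
  refine ⟨?_, fun h => ⟨x, h, rfl⟩⟩
  rintro ⟨y, hy, hyx⟩
  have : y = x := (AddCircle.coe_eq_coe_iff_of_mem_Ico (p := (1 : ℝ)) (a := 0)
    ⟨ha.trans hy.1, by linarith [hy.2]⟩ (by simpa using hx)).mp hyx
  exact this ▸ hy

theorem volume_frontier_pi_circleArc {s : ℕ} (a b : Fin s → ℝ) :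
    volume (frontier (Set.univ.pi fun i => circleArc (a i) (b i))) = 0 := by
  have hsub : frontier (Set.univ.pi fun i => circleArc (a i) (b i)) ⊆
      ⋃ i, Function.eval i ⁻¹' frontier (circleArc (a i) (b i)) := by
    rintro x ⟨hc, hi⟩
    rw [closure_pi_set, Set.mem_univ_pi] at hc
    rw [interior_pi_set Set.finite_univ, Set.mem_univ_pi, not_forall] at hi
    obtain ⟨i, hi⟩ := hi
    exact Set.mem_iUnion.mpr ⟨i, hc i, hi⟩
  refine measure_mono_null hsub (measure_iUnion_null fun i => ?_)
  exact (Measure.quasiMeasurePreserving_eval (fun _ => volume) i).preimage_null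
    (volume_frontier_circleArc _ _)

/-! ### The projections of the `m`-adic integers -/

namespace MAdicInt

variable {m : ℕ}

/-- The projection `ℤ_m → ℤ/m^n`; its value, as a natural number, is `residue n`. -/
noncomputable def proj (n : ℕ) : MAdicInt m →+* ZMod (m ^ n) :=
  (Pi.evalRingHom (fun n : ℕ => ZMod (m ^ n)) n).comp (madicSubring m).subtype

theorem val_proj (n : ℕ) (x : MAdicInt m) : (proj n x).val = residue n x := rfl

theorem castHom_castHom {a b c : ℕ} (hab : a ∣ b) (hbc : b ∣ c) (x : ZMod c) :
    ZMod.castHom hab (ZMod a) (ZMod.castHom hbc (ZMod b) x) =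
      ZMod.castHom (hab.trans hbc) (ZMod a) x :=
  RingHom.congr_fun (Subsingleton.elim
    ((ZMod.castHom hab (ZMod a)).comp (ZMod.castHom hbc (ZMod b))) _) x

theorem castHom_proj {n k : ℕ} (h : n ≤ k) (x : MAdicInt m) :
    ZMod.castHom (pow_dvd_pow m h) (ZMod (m ^ n)) (proj k x) = proj n x := by
  induction k, h using Nat.le_induction with
  | base => rw [ZMod.castHom_self, RingHom.id_apply]
  | succ k hk ih =>
    have hx : ZMod.castHom (pow_dvd_pow m k.le_succ) (ZMod (m ^ k)) (proj (k + 1) x) = proj k x :=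
      x.2 k
    rw [← ih, ← hx, castHom_castHom]

theorem ext_proj {x y : MAdicInt m} (h : ∀ n, proj n x = proj n y) : x = y :=
  Subtype.ext (funext h)

theorem proj_aeval (n : ℕ) (f : Polynomial ℤ) (x : MAdicInt m) :
    proj n (Polynomial.aeval x f) = Polynomial.aeval (proj n x) f :=
  (Polynomial.aeval_algHom_apply (proj n).toIntAlgHom x f).symm

theorem proj_eq_of_le {n k : ℕ} (h : n ≤ k) {x y : MAdicInt m} (hxy : proj k x = proj k y) :
    proj n x = proj n y := by
  rw [← castHom_proj h, hxy, castHom_proj h]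

theorem isOpen_preimage_proj (n : ℕ) (S : Set (ZMod (m ^ n))) : IsOpen (proj n ⁻¹' S) := by
  let _ : ∀ n : ℕ, TopologicalSpace (ZMod (m ^ n)) := fun _ => ⊥
  have _ : ∀ n : ℕ, DiscreteTopology (ZMod (m ^ n)) := fun _ => ⟨rfl⟩
  have hc : Continuous (fun x : MAdicInt m => proj n x) :=
    (continuous_apply n).comp continuous_induced_dom
  exact (isOpen_discrete S).preimage hc

theorem measurableSet_preimage_proj (n : ℕ) (S : Set (ZMod (m ^ n))) :
    MeasurableSet (proj n ⁻¹' S : Set (MAdicInt m)) :=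
  (isOpen_preimage_proj n S).measurableSet

/-- Any function of `ω mod m^n`, with values in any measurable space, is measurable. -/
theorem measurable_comp_proj {α : Type*} [MeasurableSpace α] (n : ℕ) (G : ZMod (m ^ n) → α) :
    Measurable (fun x : MAdicInt m => G (proj n x)) :=
  fun S _ => measurableSet_preimage_proj n (G ⁻¹' S)

/-- The ring homomorphism `ℤ_m → ℤ_p` for a prime `p ∣ m`, glued from the maps
`ℤ_m → ℤ/m^k → ℤ/p^k`. -/
noncomputable def toPadicInt (p : ℕ) [Fact p.Prime] (hp : p ∣ m) : MAdicInt m →+* ℤ_[p] :=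
  PadicInt.lift
    (f := fun k => (ZMod.castHom (pow_dvd_pow_of_dvd hp k) (ZMod (p ^ k))).comp (proj k))
    fun k₁ k₂ hk => by
      ext x
      simp only [RingHom.comp_apply]
      rw [← castHom_proj hk x, castHom_castHom, castHom_castHom]

theorem toZModPow_toPadicInt (p : ℕ) [Fact p.Prime] (hp : p ∣ m) (k : ℕ) (x : MAdicInt m) :
    PadicInt.toZModPow k (toPadicInt p hp x) =
      ZMod.castHom (pow_dvd_pow_of_dvd hp k) (ZMod (p ^ k)) (proj k x) := by
  rw [← RingHom.comp_apply, toPadicInt, PadicInt.lift_spec]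
  rfl

/-! ### Digits and `1`-Lipschitz maps -/

section Lipschitz

theorem residue_succ_mod [NeZero m] (n : ℕ) (x : MAdicInt m) :
    residue (n + 1) x % m ^ n = residue n x := by
  rw [← val_proj, ← val_proj, ← castHom_proj n.le_succ x, ZMod.castHom_apply, ZMod.cast_eq_val,
    ZMod.val_natCast]

theorem proj_eq_iff_digit_eq [NeZero m] (n : ℕ) (x y : MAdicInt m) :
    proj n x = proj n y ↔ ∀ i < n, digit i x = digit i y := by
  rw [← (ZMod.val_injective _).eq_iff, val_proj, val_proj]
  induction n with
  | zero =>
    have hz : ∀ z : MAdicInt m, residue 0 z = 0 := fun z => by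
      have h := ZMod.val_lt (proj 0 z)
      rw [val_proj, pow_zero] at h
      omega
    simp [hz]
  | succ n ih =>
    rw [Nat.forall_lt_succ_right, ← ih, ← residue_succ_mod n x, ← residue_succ_mod n y, digit,
      digit]
    refine ⟨fun h => by rw [h]; exact ⟨rfl, rfl⟩, fun h => ?_⟩
    rw [← Nat.mod_add_div (residue (n + 1) x) (m ^ n), h.1, h.2, Nat.mod_add_div]

/-- A map that is compatible with every congruence mod `m ^ n` is `1`-Lipschitz. -/
theorem oneLipschitz_of_proj [NeZero m] (hm : 1 < m) {g : MAdicInt m → MAdicInt m}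
    (hg : ∀ n x y, proj n x = proj n y → proj n (g x) = proj n (g y)) : OneLipschitz g := by
  intro ε hε x y hxy
  refine lt_of_le_of_lt ?_ hxy
  by_cases hgxy : g x = g y
  · rw [rho, if_pos hgxy, rho]
    split_ifs <;> positivity
  have hne : x ≠ y := fun h => hgxy (congrArg g h)
  rw [rho, rho, if_neg hgxy, if_neg hne]
  refine inv_anti₀ (by positivity) (pow_le_pow_right₀ (by exact_mod_cast hm.le) ?_)
  -- `sInf ∅ = 0`, so the set of positions where the images differ has to be nonempty.
  have hex : {i | digit i (g x) ≠ digit i (g y)}.Nonempty := by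
    by_contra hempty
    rw [Set.not_nonempty_iff_eq_empty, Set.eq_empty_iff_forall_notMem] at hempty
    exact hgxy (ext_proj fun n => (proj_eq_iff_digit_eq n _ _).mpr fun i _ => not_not.mp (hempty i))
  refine le_csInf hex fun i hi => le_of_not_gt fun hlt => hi ?_
  refine (proj_eq_iff_digit_eq _ _ _).mp (hg _ x y ((proj_eq_iff_digit_eq _ _ _).mpr
    fun j hj => ?_)) i hlt
  exact not_not.mp (Nat.notMem_of_lt_sInf hj)

end Lipschitz

/-! ### Haar measure and zero sets of polynomials -/

section Haar

variable [NeZero m]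

instance : IsProbabilityMeasure (haar m) := ⟨Measure.addHaarMeasure_self⟩

instance : (haar m).IsAddLeftInvariant :=
  inferInstanceAs (Measure.addHaarMeasure ⊤).IsAddLeftInvariant

/-- The classes mod `m ^ d` are translates of each other and cover `ℤ_m`, so none is null. -/
theorem haar_proj_eq_ne_zero (d : ℕ) {β : ℕ} (hβ : β < m ^ d) :
    haar m {ω | residue d ω = β} ≠ 0 := by
  intro h0
  have hall : ∀ c : ZMod (m ^ d), haar m (proj d ⁻¹' {c}) = 0 := by
    intro c
    rw [← h0, ← measure_preimage_add (haar m) ((β : MAdicInt m) - (c.val : MAdicInt m))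
      {ω : MAdicInt m | residue d ω = β}]
    congr 1
    ext ω
    have hiff : residue d ((β : MAdicInt m) - (c.val : MAdicInt m) + ω) = β ↔
        proj d ((β : MAdicInt m) - (c.val : MAdicInt m) + ω) = (β : ZMod (m ^ d)) := by
      rw [← val_proj, ← (ZMod.val_injective _).eq_iff, ZMod.val_natCast_of_lt hβ]
    simp only [Set.mem_preimage, Set.mem_singleton_iff, Set.mem_ofPred_eq]
    rw [hiff]
    simp only [map_add, map_sub, map_natCast, ZMod.natCast_zmod_val]
    constructor
    · rintro rfl; ring
    · intro h; linear_combination h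
  have huniv : (Set.univ : Set (MAdicInt m)) = ⋃ c : ZMod (m ^ d), proj d ⁻¹' {c} := by
    ext ω; simp
  have h1 : haar m Set.univ = 1 := measure_univ
  rw [huniv, measure_iUnion_null hall] at h1
  exact zero_ne_one h1

/-- A set whose translates by the rational integers are pairwise disjoint is null, since these
translates have equal measure and total measure at most `1`. -/
theorem haar_null_of_translates {S : Set (MAdicInt m)} (hS : MeasurableSet S)
    (hdisj : Pairwise (Function.onFun Disjoint fun z : ℤ =>
      (fun ω : MAdicInt m => (z : MAdicInt m) + ω) ⁻¹' S)) :
    haar m S = 0 := by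
  by_contra hne
  have hsum := measure_iUnion (μ := haar m) hdisj fun z =>
    hS.preimage (measurable_const_add (z : MAdicInt m))
  simp only [measure_preimage_add] at hsum
  rw [ENNReal.tsum_const_eq_top_of_ne_zero hne] at hsum
  exact measure_ne_top _ _ hsum

theorem haar_toPadicInt_fiber (p : ℕ) [Fact p.Prime] (hp : p ∣ m) (c : ℤ_[p]) :
    haar m (toPadicInt p hp ⁻¹' {c}) = 0 := by
  refine haar_null_of_translates ?_ ?_
  · have hS : (toPadicInt p hp ⁻¹' {c} : Set (MAdicInt m)) =
        ⋂ k, proj k ⁻¹' {b | ZMod.castHom (pow_dvd_pow_of_dvd hp k) (ZMod (p ^ k)) b =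
          PadicInt.toZModPow k c} := by
      ext x
      simp only [Set.mem_preimage, Set.mem_singleton_iff, Set.mem_iInter, Set.mem_ofPred_eq,
        ← toZModPow_toPadicInt p hp]
      exact PadicInt.ext_of_toZModPow.symm
    rw [hS]
    exact MeasurableSet.iInter fun k => measurableSet_preimage_proj k _
  · intro z₁ z₂ hz
    refine Set.disjoint_left.mpr fun ω h₁ h₂ => hz ?_
    simp only [Set.mem_preimage, Set.mem_singleton_iff, map_add, map_intCast] at h₁ h₂
    exact_mod_cast add_right_cancel (h₁.trans h₂.symm)

/-- The zero set in `ℤ_m` of a nonzero integer polynomial is null. As `ℤ_m` need not be a domain,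
this set may be infinite; its image in `ℤ_p` is finite. -/
theorem haar_zeros_eq_zero (hm : 1 < m) {R : Polynomial ℤ} (hR : R ≠ 0) :
    haar m {ω | Polynomial.aeval ω R = 0} = 0 := by
  obtain ⟨p, hp, hpm⟩ := Nat.exists_prime_and_dvd hm.ne'
  have := Fact.mk hp
  classical
  have hsub : {ω : MAdicInt m | Polynomial.aeval ω R = 0} ⊆
      ⋃ c ∈ (R.map (Int.castRingHom ℤ_[p])).roots.toFinset, toPadicInt p hpm ⁻¹' {c} := by
    intro ω hω
    have hR' : R.map (Int.castRingHom ℤ_[p]) ≠ 0 :=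
      (Polynomial.map_ne_zero_iff (RingHom.injective_int _)).mpr hR
    simp only [Set.mem_iUnion, Multiset.mem_toFinset, Set.mem_preimage, Set.mem_singleton_iff,
      exists_prop, exists_eq_right', Polynomial.mem_roots hR', Polynomial.IsRoot.def]
    have h := Polynomial.aeval_algHom_apply (toPadicInt p hpm).toIntAlgHom ω R
    rw [show Polynomial.aeval ω R = 0 from hω, map_zero, Polynomial.aeval_def,
      Polynomial.eval₂_eq_eval_map] at h
    exact h
  exact measure_mono_null hsub ((measure_biUnion_null_iff (Finset.countable_toSet _)).mpr
    fun c _ => haar_toPadicInt_fiber p hpm c)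

theorem tendsto_haar_proj_aeval_eq_zero (hm : 1 < m) {R : Polynomial ℤ} (hR : R ≠ 0) :
    Tendsto (fun k => haar m {ω | proj k (Polynomial.aeval ω R) = 0}) atTop (𝓝 0) := by
  have hinter : ⋂ k, {ω : MAdicInt m | proj k (Polynomial.aeval ω R) = 0} =
      {ω | Polynomial.aeval ω R = 0} := by
    ext ω
    simp only [Set.mem_iInter, Set.mem_ofPred_eq]
    exact ⟨fun h => ext_proj fun k => by rw [h k, map_zero], fun h k => by rw [h, map_zero]⟩
  rw [← haar_zeros_eq_zero hm hR, ← hinter]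
  refine tendsto_measure_iInter_atTop (fun k => ?_) (fun k l hkl ω hω => ?_)
    ⟨0, measure_ne_top _ _⟩
  · simp only [proj_aeval]
    exact (measurableSet_preimage_proj k {b | Polynomial.aeval b R = 0}).nullMeasurableSet
  · have h : proj l (Polynomial.aeval ω R) = proj l 0 := by rw [map_zero]; exact hω
    simpa using proj_eq_of_le hkl h

end Haar
/-! ### The exponential integral -/

theorem proj_pow_mul_add {d t : ℕ} (h : d ≤ t) (z ω : MAdicInt m) :
    proj d ((m : MAdicInt m) ^ t * z + ω) = proj d ω := by
  have h0 : (m : ZMod (m ^ d)) ^ t = 0 := by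
    rw [← Nat.cast_pow, ZMod.natCast_eq_zero_iff]
    exact pow_dvd_pow m h
  rw [map_add, map_mul, map_pow, map_natCast, h0, zero_mul, zero_add]

/-- First-order Taylor expansion mod `m ^ n`: the terms of order at least two carry the factor
`m ^ (2 * t)`. -/
theorem proj_aeval_pow_mul_add {n t : ℕ} (h : n ≤ 2 * t) (P : Polynomial ℤ) (z ω : MAdicInt m) :
    proj n (Polynomial.aeval ((m : MAdicInt m) ^ t * z + ω) P) =
      proj n (Polynomial.aeval ω P) +
        proj n z * ((m : ZMod (m ^ n)) ^ t * proj n (Polynomial.aeval ω P.derivative)) := by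
  have h0 : (m : ZMod (m ^ n)) ^ t * (m : ZMod (m ^ n)) ^ t = 0 := by
    rw [← pow_add, ← Nat.cast_pow, ZMod.natCast_eq_zero_iff]
    exact pow_dvd_pow m (by omega)
  obtain ⟨k, hk⟩ := (P.map (Int.castRingHom (MAdicInt m))).binomExpansion ω
    ((m : MAdicInt m) ^ t * z)
  rw [Polynomial.derivative_map, Polynomial.eval_map, Polynomial.eval_map,
    Polynomial.eval_map] at hk
  rw [add_comm, Polynomial.aeval_def, Polynomial.aeval_def, Polynomial.aeval_def]
  change proj n (Polynomial.eval₂ (Int.castRingHom (MAdicInt m)) _ P) = _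
  rw [hk]
  simp only [map_add, map_mul, map_pow, map_natCast]
  change proj n (Polynomial.eval₂ (Int.castRingHom (MAdicInt m)) _ P) + _ * _ + _ =
    proj n (Polynomial.eval₂ (Int.castRingHom (MAdicInt m)) _ P) + _
  change _ = _ + _ * (_ * proj n (Polynomial.eval₂ (Int.castRingHom (MAdicInt m)) _ P.derivative))
  linear_combination proj n k * proj n z ^ 2 * h0

variable [NeZero m]

theorem proj_sub_eq_zero {n t : ℕ} (ht : t ≤ n) {x : MAdicInt m}
    (hx : (m : ZMod (m ^ n)) ^ t * proj n x = 0) : proj (n - t) x = 0 := by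
  rw [← ZMod.natCast_zmod_val (proj n x), ← Nat.cast_pow, ← Nat.cast_mul,
    ZMod.natCast_eq_zero_iff] at hx
  rw [← castHom_proj (Nat.sub_le n t), ← ZMod.natCast_zmod_val (proj n x), map_natCast,
    ZMod.natCast_eq_zero_iff]
  refine Nat.dvd_of_mul_dvd_mul_left (pow_pos (NeZero.pos m) t) ?_
  rwa [← pow_add, Nat.add_sub_cancel' ht]

/-- Averaging over the shifts by `m ^ t * z` leaves only the points where `P'` vanishes
mod `m ^ (n - t)`. -/
theorem norm_setIntegral_stdAddChar_le {d t n : ℕ} (hdt : d ≤ t) (htn : t ≤ n) (hnt : n ≤ 2 * t)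
    (P : Polynomial ℤ) (β : ℕ) :
    ‖∫ ω in {ω : MAdicInt m | residue d ω = β},
        (ZMod.stdAddChar (proj n (Polynomial.aeval ω P)) : ℂ) ∂haar m‖ ≤
      (haar m).real {ω | proj (n - t) (Polynomial.aeval ω P.derivative) = 0} := by
  set B : Set (MAdicInt m) := {ω | residue d ω = β} with hB
  have hBm : MeasurableSet B := measurableSet_preimage_proj d {c | c.val = β}
  set F : MAdicInt m → ℂ :=
    B.indicator fun ω => ZMod.stdAddChar (proj n (Polynomial.aeval ω P)) with hF
  set b : MAdicInt m → ZMod (m ^ n) :=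
    fun ω => (m : ZMod (m ^ n)) ^ t * proj n (Polynomial.aeval ω P.derivative) with hb
  have hchar : ∀ c : ZMod (m ^ n), ‖(ZMod.stdAddChar c : ℂ)‖ = 1 := fun c => by
    rw [ZMod.stdAddChar_apply, Circle.norm_coe]
  have hFnorm : ∀ ω, ‖F ω‖ ≤ 1 := fun ω =>
    (norm_indicator_le_norm_self _ _).trans (hchar _).le
  have hFmeas : Measurable F := by
    refine Measurable.indicator ?_ hBm
    simp only [proj_aeval]
    exact measurable_comp_proj n fun c => (ZMod.stdAddChar (Polynomial.aeval c P) : ℂ)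
  have hbmeas : ∀ G : ZMod (m ^ n) → ℂ, Measurable fun ω => G (b ω) := fun G => by
    simp only [hb, proj_aeval]
    exact measurable_comp_proj n fun c =>
      G ((m : ZMod (m ^ n)) ^ t * Polynomial.aeval c P.derivative)
  have hshift : ∀ z : ZMod (m ^ n), ∫ ω, F ω ∂haar m =
      ∫ ω, F ω * (ZMod.stdAddChar (z * b ω) : ℂ) ∂haar m := by
    intro z
    rw [← integral_add_left_eq_self F ((m : MAdicInt m) ^ t * (z.val : MAdicInt m))]
    congr 1
    ext ω
    have hmem : (m : MAdicInt m) ^ t * (z.val : MAdicInt m) + ω ∈ B ↔ ω ∈ B := by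
      simp only [hB, Set.mem_ofPred_eq, ← val_proj, proj_pow_mul_add hdt]
    by_cases hω : ω ∈ B
    · rw [hF, Set.indicator_of_mem hω, Set.indicator_of_mem (hmem.mpr hω),
        proj_aeval_pow_mul_add hnt, AddChar.map_add_eq_mul, map_natCast, ZMod.natCast_zmod_val]
    · rw [hF, Set.indicator_of_notMem hω, Set.indicator_of_notMem (mt hmem.mp hω), zero_mul]
  have hint : ∀ z : ZMod (m ^ n),
      Integrable (fun ω => F ω * (ZMod.stdAddChar (z * b ω) : ℂ)) (haar m) := fun z =>
    Integrable.of_bound (hFmeas.mul (hbmeas fun c => ZMod.stdAddChar (z * c))).aestronglyMeasurable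
      1 (ae_of_all _ fun ω => by rw [norm_mul, hchar, mul_one]; exact hFnorm ω)
  have hN : ((m ^ n : ℕ) : ℂ) ≠ 0 := by exact_mod_cast NeZero.ne (m ^ n)
  have hZm : MeasurableSet {ω : MAdicInt m | b ω = 0} := by
    simp only [hb, proj_aeval]
    exact measurableSet_preimage_proj n
      {c | (m : ZMod (m ^ n)) ^ t * Polynomial.aeval c P.derivative = 0}
  have hmain : ∫ ω, F ω ∂haar m = ∫ ω in {ω | b ω = 0}, F ω ∂haar m := by
    refine mul_left_cancel₀ hN ?_
    calc ((m ^ n : ℕ) : ℂ) * ∫ ω, F ω ∂haar m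
        = ∑ z : ZMod (m ^ n), ∫ ω, F ω * (ZMod.stdAddChar (z * b ω) : ℂ) ∂haar m := by
          rw [← Finset.sum_congr rfl fun z _ => hshift z, Finset.sum_const, Finset.card_univ,
            ZMod.card, nsmul_eq_mul]
      _ = ∫ ω, ((m ^ n : ℕ) : ℂ) * Set.indicator {ω | b ω = 0} F ω ∂haar m := by
          rw [← integral_finsetSum _ fun z _ => hint z]
          congr 1
          ext ω
          rw [← Finset.mul_sum, AddChar.sum_mulShift _ (ZMod.isPrimitive_stdAddChar _), ZMod.card]
          by_cases hω : b ω = 0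
          · rw [if_pos hω, Set.indicator_of_mem (show ω ∈ {ω | b ω = 0} from hω), mul_comm]
          · rw [if_neg hω, Set.indicator_of_notMem (show ω ∉ {ω | b ω = 0} from hω)]
            simp
      _ = _ := by rw [integral_const_mul, integral_indicator hZm]
  rw [← integral_indicator hBm, hmain]
  refine (norm_setIntegral_le_of_norm_le_const (measure_lt_top _ _) fun ω _ => hFnorm ω).trans ?_
  rw [one_mul]
  exact measureReal_mono fun ω hω => proj_sub_eq_zero htn hω

theorem tendsto_setIntegral_stdAddChar (hm : 1 < m) {P : Polynomial ℤ} (hP : P.derivative ≠ 0)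
    (d β : ℕ) :
    Tendsto (fun n => ∫ ω in {ω : MAdicInt m | residue d ω = β},
      (ZMod.stdAddChar (proj n (Polynomial.aeval ω P)) : ℂ) ∂haar m) atTop (𝓝 0) := by
  have hlim := (ENNReal.tendsto_toReal ENNReal.zero_ne_top).comp
    ((tendsto_haar_proj_aeval_eq_zero hm hP).comp (Nat.tendsto_div_const_atTop two_ne_zero))
  refine squeeze_zero_norm' ?_ hlim
  -- The shift is by `m ^ t` with `t = n - n / 2`, the least `t` with `n ≤ 2 * t`.
  filter_upwards [eventually_ge_atTop (2 * d)] with n hn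
  have h := norm_setIntegral_stdAddChar_le (m := m) (d := d) (t := n - n / 2) (n := n)
    (by omega) (by omega) (by omega) P β
  rwa [show n - (n - n / 2) = n / 2 by omega] at h

end MAdicInt

/-! ### Integer combinations of the iterates of a polynomial -/

/-- A nontrivial integer combination of the iterates of `f` is not constant: for the largest index
`i` that occurs, its coefficient at `(deg f) ^ i` comes from the `i`-th iterate alone. -/
theorem derivative_sum_smul_iterate_comp_ne_zero {f : Polynomial ℤ} (hf : 1 < f.natDegree) {s : ℕ}
    {h : Fin s → ℤ} (hh : h ≠ 0) :
    Polynomial.derivative (∑ i : Fin s, h i • f.comp^[i] Polynomial.X) ≠ 0 := by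
  classical
  have hdeg : ∀ i : ℕ, (f.comp^[i] Polynomial.X).natDegree = f.natDegree ^ i := fun i => by
    rw [Polynomial.natDegree_iterate_comp, Polynomial.natDegree_X, mul_one]
  obtain ⟨j, hj⟩ := Function.ne_iff.mp hh
  obtain ⟨i, hi, hmax⟩ := (Finset.univ.filter fun i => h i ≠ 0).exists_maximal
    ⟨j, by simpa using hj⟩
  have hhi : h i ≠ 0 := by simpa using hi
  have hpos : 0 < f.natDegree ^ (i : ℕ) := pow_pos (by omega) _
  have hcoeff : (∑ k : Fin s, h k • f.comp^[k] Polynomial.X).coeff (f.natDegree ^ (i : ℕ)) ≠ 0 := by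
    rw [Polynomial.finsetSum_coeff, Finset.sum_eq_single i]
    · rw [Polynomial.coeff_smul, smul_eq_mul, ← hdeg]
      refine mul_ne_zero hhi (Polynomial.leadingCoeff_ne_zero.mpr fun h0 => ?_)
      rw [← hdeg, h0] at hpos
      simp at hpos
    · intro k _ hki
      by_cases hhk : h k = 0
      · simp [hhk]
      have hle : k < i := lt_of_le_of_ne
        (le_of_not_gt fun hik => hik.not_ge (hmax (by simpa using hhk) hik.le)) hki
      rw [Polynomial.coeff_smul, Polynomial.coeff_eq_zero_of_natDegree_lt, smul_zero]
      rw [hdeg]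
      exact Nat.pow_lt_pow_right hf hle
    · simp
  intro h0
  have h1 := congrArg (Polynomial.coeff · (f.natDegree ^ (i : ℕ) - 1)) h0
  simp only [Polynomial.coeff_derivative, Polynomial.coeff_zero, Nat.sub_add_cancel hpos] at h1
  refine mul_ne_zero hcoeff ?_ h1
  exact Nat.cast_add_one_ne_zero _

theorem iterate_aeval_eq_aeval_iterate_comp {R : Type*} [CommRing R] (f : Polynomial ℤ) (i : ℕ)
    (x : R) : (fun x : R => Polynomial.aeval x f)^[i] x =
      Polynomial.aeval x (f.comp^[i] Polynomial.X) := by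
  simp only [Polynomial.aeval_def, Polynomial.iterate_comp_eval₂, Polynomial.eval₂_X]

/-! ### The random vector as a point of the torus -/

theorem mFourier_toAddCircle {N : ℕ} [NeZero N] {s : ℕ} (h : Fin s → ℤ) (a : Fin s → ZMod N) :
    UnitAddTorus.mFourier h (fun i => ZMod.toAddCircle (a i)) =
      (ZMod.stdAddChar (∑ i, h i • a i) : ℂ) := by
  simp only [UnitAddTorus.mFourier, ContinuousMap.coe_mk, fourier_apply, ← map_zsmul]
  have hsum : ∀ S : Finset (Fin s), ∏ i ∈ S, ((ZMod.toAddCircle (h i • a i)).toCircle : ℂ) =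
      (ZMod.stdAddChar (∑ i ∈ S, h i • a i) : ℂ) := fun S => by
    induction S using Finset.cons_induction with
    | empty => simp
    | cons i S hi ih =>
      rw [Finset.prod_cons, Finset.sum_cons, AddChar.map_add_eq_mul, ih]
      rfl
  exact hsum Finset.univ

namespace MAdicInt

variable {m : ℕ} [NeZero m]

theorem volume_cube {s : ℕ} (k : ℕ) (a : Fin s → Fin (m ^ k)) :
    volume (cube k a) = volume (Set.univ.pi fun i =>
      circleArc ((a i : ℕ) / (m : ℝ) ^ k) (((a i : ℕ) + 1) / (m : ℝ) ^ k)) := by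
  have hpos : (0 : ℝ) < (m : ℝ) ^ k := pow_pos (by exact_mod_cast NeZero.pos m) k
  have hone : (1 : ℝ) ≤ (m : ℝ) ^ k := one_le_pow₀ (by exact_mod_cast NeZero.pos m)
  have hcube : cube k a = Set.univ.pi fun i =>
      Set.Ico ((a i : ℕ) / (m : ℝ) ^ k) (((a i : ℕ) + 1) / (m : ℝ) ^ k) := by
    ext z
    simp only [cube, Set.mem_univ_pi, Set.mem_Ico, Set.mem_ofPred_eq]
  rw [hcube, volume_pi_pi, volume_pi_pi]
  refine Finset.prod_congr rfl fun i _ => ?_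
  rw [Real.volume_Ico, volume_circleArc]
  · gcongr; linarith
  · rw [add_div]
    gcongr
    exact (div_le_one hpos).mpr hone

theorem phi_mem_cube_iff {s : ℕ} (g : Fin s → MAdicInt m → MAdicInt m) (n k : ℕ)
    (a : Fin s → Fin (m ^ k)) (ω : MAdicInt m) :
    phi g n ω ∈ cube k a ↔
      (fun i => ZMod.toAddCircle (proj n (g i ω))) ∈ Set.univ.pi fun i =>
        circleArc ((a i : ℕ) / (m : ℝ) ^ k) (((a i : ℕ) + 1) / (m : ℝ) ^ k) := by
  have hpos : ∀ l, (0 : ℝ) < (m : ℝ) ^ l := fun l => pow_pos (by exact_mod_cast NeZero.pos m) l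
  simp only [cube, phi, Set.mem_univ_pi, Set.mem_ofPred_eq]
  refine forall_congr' fun i => ?_
  have hlt : (residue n (g i ω) : ℝ) < (m : ℝ) ^ n := by
    exact_mod_cast ZMod.val_lt (proj n (g i ω))
  have ha : ((a i : ℕ) : ℝ) + 1 ≤ (m : ℝ) ^ k := by exact_mod_cast (a i).isLt
  rw [ZMod.toAddCircle_apply, val_proj, Nat.cast_pow, coe_mem_circleArc_iff (by positivity)
    ((div_le_one (hpos k)).mpr ha) ⟨by positivity, (div_lt_one (hpos n)).mpr hlt⟩, Set.mem_Ico]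

end MAdicInt

theorem theorem5 (m : ℕ) [NeZero m] (hm : 1 < m) (f : Polynomial ℤ) (hf : 1 < f.natDegree)
    (s : ℕ) :
    MAdicInt.UniformWithEachSuffix
      (fun (i : Fin s) => (fun x : MAdicInt m => Polynomial.aeval x f)^[(i : ℕ)]) := by
  have hiter : ∀ (n i : ℕ) (ω : MAdicInt m),
      MAdicInt.proj n ((fun x : MAdicInt m => Polynomial.aeval x f)^[i] ω) =
        Polynomial.aeval (MAdicInt.proj n ω) (f.comp^[i] Polynomial.X) := fun n i ω => by
    rw [iterate_aeval_eq_aeval_iterate_comp, MAdicInt.proj_aeval]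
  refine ⟨fun i => MAdicInt.oneLipschitz_of_proj hm fun n x y hxy => ?_, fun k a d β => ?_⟩
  · rw [hiter, hiter, hxy]
  set B : Set (MAdicInt m) := {ω | MAdicInt.residue d ω = (β : ℕ)}
  have hB : MAdicInt.haar m B ≠ 0 := MAdicInt.haar_proj_eq_ne_zero d β.isLt
  have hprob := ProbabilityTheory.cond_isProbabilityMeasure hB
  -- The point of the torus with coordinates `f^(i)(ω) / m^n` mod `1`.
  set Φ : ℕ → MAdicInt m → UnitAddTorus (Fin s) := fun n ω i =>
    ZMod.toAddCircle (MAdicInt.proj n ((fun x : MAdicInt m => Polynomial.aeval x f)^[(i : ℕ)] ω))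
    with hΦdef
  have hΦ : ∀ n, Measurable (Φ n) := fun n => by
    simp only [hΦdef, hiter]
    exact MAdicInt.measurable_comp_proj n fun c (i : Fin s) =>
      ZMod.toAddCircle (Polynomial.aeval c (f.comp^[(i : ℕ)] Polynomial.X))
  have hmap : ∀ n, IsProbabilityMeasure
      ((ProbabilityTheory.cond (MAdicInt.haar m) B).map (Φ n)) := fun n =>
    Measure.isProbabilityMeasure_map (hΦ n).aemeasurable
  have hE := volume_frontier_pi_circleArc (s := s) (fun i => ((a i : ℕ) : ℝ) / (m : ℝ) ^ k)
    (fun i => (((a i : ℕ) : ℝ) + 1) / (m : ℝ) ^ k)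
  rw [MAdicInt.volume_cube]
  refine (tendsto_measure_of_tendsto_mFourier
    (μs := fun n => (ProbabilityTheory.cond (MAdicInt.haar m) B).map (Φ n))
    (fun h hh => ?_) hE).congr fun n => ?_
  · have hexp := MAdicInt.tendsto_setIntegral_stdAddChar hm
      (derivative_sum_smul_iterate_comp_ne_zero hf hh) d β
    have hlim := hexp.const_smul (MAdicInt.haar m B)⁻¹.toReal
    rw [smul_zero] at hlim
    refine hlim.congr fun n => ?_
    rw [integral_map (hΦ n).aemeasurable
      (UnitAddTorus.mFourier h).continuous.aestronglyMeasurable, ProbabilityTheory.cond,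
      integral_smul_measure]
    congr 2
    ext ω
    simp only [hΦdef, mFourier_toAddCircle, iterate_aeval_eq_aeval_iterate_comp, map_sum, map_zsmul]
  · rw [Measure.map_apply (hΦ n)]
    · congr 1
      ext ω
      exact (MAdicInt.phi_mem_cube_iff _ n k a ω).symm
    · refine MeasurableSet.univ_pi fun i => measurableSet_circleArc ?_
      have : (0 : ℝ) < (m : ℝ) ^ k := pow_pos (by exact_mod_cast NeZero.pos m) k
      gcongr
      linarith
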